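/- **Setting.** Fix $n,m\in\mathbb{N}$, a real vector space $W$ (for instance $W=L_2(D)$ with $D\subset\mathbb{R}^d$) and a normed vector space $(\mathcal V,\|\cdot\|_{\mathcal V})$ with $\mathcal V\subseteq W$. An *information set* is a family $\mathcal I=(f_1,\dots,f_n)\in W^n$; let $\mathcal A\subseteq W^n$ be the class of admissible information sets (possibly all of $W^n$) and $X_0\subseteq\mathbb{R}^m$ the set of allowable initial states (possibly all of $\mathbb{R}^m$). Two information sets are *$\mathcal V$-adjacent* if for some $i_0$ they agree in all entries $i\neq i_0$ and $f_{i_0}-f'_{i_0}\in\mathcal V$. With each $\mathcal I$ are associated an optimizer $x^*_{\mathcal I}\in\mathbb{R}^m$ and a map $a_{\mathcal I}:\mathbb{R}^m\times\mathbb{R}^m\to\mathbb{R}^m$. The message-perturbing algorithm is $$x(k+1)=a_{\mathcal I}(x(k),\xi(k)),\qquad \xi(k)=x(k)+\eta(k),\qquad x(0)=x_0,\quad k\ge 0 .$$ Write $\tilde a_{\mathcal I}(x,\eta)=a_{\mathcal I}(x,x+\eta)$. The noise $\eta(k)\in\mathbb{R}^m$ has coordinates $\eta_i(k)$ that are independent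 over all $i$ and $k$, with $\eta_i(k)\sim\mathrm{Lap}(b_i(k))$ or $\eta_i(k)\sim\mathcal N(0,b_i(k))$, $b_i(k)>0$; here $\mathrm{Lap}(b)$ has density $\frac1{2b}e^{-|x|/b}$ and $\mathcal N(0,b)$ has variance $b$. For $\epsilon\in\mathbb{R}_{>0}^n$, the algorithm *preserves $\epsilon$-differential privacy* if for every initial state $x_0\in X_0$, all $\mathcal V$-adjacent $F,F'\in\mathcal A$ that differ at most in their $i_0$-th element, and every measurable set $\mathcal O$ of sequences in $\mathbb{R}^m$, $$\mathbb{P}\{\boldsymbol\xi_{F',x_0}\in\mathcal O\}\le e^{\epsilon_{i_0}\|f_{i_0}-f'_{i_0}\|_{\mathcal V}}\;\mathbb{P}\{\boldsymbol\xi_{F,x_0}\in\mathcal O\},$$ where $\boldsymbol\xi_{F,x_0}=(\xi(k))_{k\ge0}$ is the whole sequence of messages produced with information set $F$. **Stability.** Let $|\cdot|$ be the Euclidean norm and $B(c,r)$ the closed ball. $\mathcal K$ is the set of strictly increasing continuous $\kappa:[0,\infty)\to[0,\infty)$ with $\kappa(0)=0$; $\mathcal{KL}$ is the set of $\gamma:[0,\infty)^2\to[0,\infty)$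 such that each $\gamma(\cdot,s)$ is nondecreasing and continuous with $\gamma(0,s)=0$, and each $\gamma(r,\cdot)$ is nonincreasing with limit $0$ at infinity. Consider a system $x(k+1)=f(x(k),\eta(k))$ and a point $x^*$. - The system is *0-LAS relative to $x^*$* if there are $\rho>0$ and $\gamma\in\mathcal{KL}$ such that, for $\boldsymbol\eta=0$, $|x(k)-x^*|\le\gamma(|x(0)-x^*|,k)$ for all $x(0)\in B(x^*,\rho)$ and $k\ge0$. - $\rho>0$ is a *robust stability radius relative to $x^*$* if there are $\gamma\in\mathcal{KL}$ and $\kappa\in\mathcal K$ such that $|x(k)-x^*|\le\max\{\gamma(|x(0)-x^*|,k),\kappa(\max_{j<k}|\eta(j)|)\}$ for all $x(0)\in B(x^*,\rho)$, all inputs with $\sup_j|\eta(j)|\le\rho$, and all $k\ge1$. The system is *LISS relative to $x^*$* if it has a robust stability radius. **Proposition.** Let $b_i(k)=O(1/k^p)$ as $k\to\infty$ for all $i\in\{1,\dots,m\}$ and some $p>0$. Let $\mathcal I,\mathcal I'$ be information sets that are $\mathcal V$-adjacent and admissible (or, more generally, that can be joined by a finite chain of admissible information sets with consecutive ones $\mathcal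 V$-adjacent), with $x^*_{\mathcal I}\ne x^*_{\mathcal I'}$ and $x^*_{\mathcal I}\in X_0$. Suppose that $\tilde a_{\mathcal I}$ is 0-LAS relative to $x^*_{\mathcal I}$ and $\tilde a_{\mathcal I'}$ is 0-LAS relative to $x^*_{\mathcal I'}$, and that $\tilde a_{\mathcal I}$ is LISS relative to $x^*_{\mathcal I}$ or continuous. Suppose also that at least one of the following holds: 1. $x^*_{\mathcal I}$ is not an equilibrium point of $x(k+1)=\tilde a_{\mathcal I'}(x(k),0)$, and $\tilde a_{\mathcal I'}$ is continuous; 2. $\tilde a_{\mathcal I'}$ has a robust stability radius $\rho'$ relative to $x^*_{\mathcal I'}$ such that $x^*_{\mathcal I}$ belongs to the interior of $B(x^*_{\mathcal I'},\rho')$. Then the algorithm does not preserve $\epsilon$-differential privacy for any $\epsilon\in\mathbb{R}_{>0}^n$. -/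

import Mathlib

open Filter Topology MeasureTheory ProbabilityTheory Asymptotics
open scoped NNReal ENNReal

noncomputable section

namespace MessagePerturbing

/-! ### Comparison functions -/

/-- Class `𝒦`: strictly increasing continuous functions `[0, ∞) → [0, ∞)` vanishing at zero. -/
structure IsClassK (α : ℝ≥0 → ℝ≥0) : Prop where
  strictMono : StrictMono α
  continuous : Continuous α
  map_zero : α 0 = 0

/-- Class `𝒦ℒ`: functions `β : [0, ∞) × [0, ∞) → [0, ∞)` with `β (·, s)` nondecreasing, continuous
and zero at zero, and `β (r, ·)` monotonically decreasing with limit zero at infinity. -/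
structure IsClassKL (β : ℝ≥0 → ℝ≥0 → ℝ≥0) : Prop where
  monotone : ∀ s, Monotone (fun r => β r s)
  continuous : ∀ s, Continuous (fun r => β r s)
  map_zero : ∀ s, β 0 s = 0
  antitone : ∀ r, Antitone (β r)
  tendsto_zero : ∀ r, Tendsto (β r) atTop (𝓝 0)

/-! ### Discrete-time systems with input -/

section Systems

variable {X U : Type*}

/-- The solution of `x (k + 1) = f (x k) (η k)` with `x 0 = x₀`. -/
def trajectory (f : X → U → X) (x₀ : X) (η : ℕ → U) : ℕ → X
  | 0 => x₀
  | k + 1 => f (trajectory f x₀ η k) (η k)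

variable [NormedAddCommGroup X] [NormedAddCommGroup U]

/-- 0-input local asymptotic stability relative to `xs`. (The estimate forces `f xs 0 = xs`.) -/
def IsZeroLAS (f : X → U → X) (xs : X) : Prop :=
  ∃ ρ : ℝ, 0 < ρ ∧ ∃ γ : ℝ≥0 → ℝ≥0 → ℝ≥0, IsClassKL γ ∧
    ∀ x₀ ∈ Metric.closedBall xs ρ, ∀ k : ℕ,
      ‖trajectory f x₀ (fun _ => 0) k - xs‖₊ ≤ γ ‖x₀ - xs‖₊ k

/-- `ρ` is a robust stability radius of `x (k + 1) = f (x k) (η k)` relative to `xs`: the local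
input-to-state stability estimate holds for all initial states in the closed ball of radius `ρ`
about `xs` and all inputs bounded by `ρ`. (The estimate forces `f xs 0 = xs`.) -/
def IsRobustStabilityRadius (f : X → U → X) (xs : X) (ρ : ℝ) : Prop :=
  0 < ρ ∧ ∃ γ : ℝ≥0 → ℝ≥0 → ℝ≥0, ∃ κ : ℝ≥0 → ℝ≥0, IsClassKL γ ∧ IsClassK κ ∧
    ∀ x₀ ∈ Metric.closedBall xs ρ, ∀ η : ℕ → U, (∀ k, ‖η k‖ ≤ ρ) →
      ∀ k : ℕ, 1 ≤ k →
        ‖trajectory f x₀ η k - xs‖₊ ≤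
          max (γ ‖x₀ - xs‖₊ k) (κ ((Finset.range k).sup fun j => ‖η j‖₊))

/-- Local input-to-state stability relative to `xs`. -/
def IsLISS (f : X → U → X) (xs : X) : Prop :=
  ∃ ρ : ℝ, IsRobustStabilityRadius f xs ρ

/-- The system `ã (x, η) = a (x, x + η)` with the perturbation as its input. -/
def perturbedSystem (a : X → X → X) : X → X → X :=
  fun x η => a x (x + η)

/-- The sequence of messages `ξ k = x k + η k`, where `x (k + 1) = a (x k) (ξ k)`, `x 0 = x₀`. -/
def messages (a : X → X → X) (x₀ : X) (η : ℕ → X) : ℕ → X :=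
  fun k => trajectory (perturbedSystem a) x₀ η k + η k

end Systems

/-! ### Noise -/

/-- The zero-mean Laplace distribution with scale `b > 0`. -/
def laplace (b : ℝ) : Measure ℝ :=
  volume.withDensity fun x => ENNReal.ofReal (1 / (2 * b) * Real.exp (-|x| / b))

/-- `η` is a sequence of random vectors whose coordinates are independent, over both coordinates
and time, the `i`-th one at time `k` having law `Lap (b i k)` or `𝒩 (0, b i k)`. -/
structure IsLaplaceOrGaussianNoise {Ω : Type*} [MeasurableSpace Ω] (P : Measure Ω) {m : ℕ}
    (b : Fin m → ℕ → ℝ≥0) (η : Ω → ℕ → EuclideanSpace ℝ (Fin m)) : Prop where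
  scale_pos : ∀ i k, 0 < b i k
  measurable : ∀ (k : ℕ) (i : Fin m), Measurable fun ω => η ω k i
  indep : iIndepFun (fun (p : ℕ × Fin m) ω => η ω p.1 p.2) P
  law : ∀ (k : ℕ) (i : Fin m),
    P.map (fun ω => η ω k i) = laplace (b i k) ∨
      P.map (fun ω => η ω k i) = gaussianReal 0 (b i k)

/-! ### Adjacency and differential privacy -/

/-- A normed vector space contained (as a vector space) in `W`. Its norm need not be related to
any norm on `W`. -/
structure AdjacencySpace (W : Type*) [AddCommGroup W] [Module ℝ W] where
  space : Submodule ℝ W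
  norm : Seminorm ℝ space
  eq_zero_of_norm_eq_zero : ∀ v, norm v = 0 → v = 0

section Privacy

variable {W : Type*} [AddCommGroup W] [Module ℝ W] {n : ℕ}

/-- `F` and `F'` are adjacent at agent `i₀`: they agree except possibly at `i₀`, where the
difference lies in the adjacency space. -/
def AdjacentAt (V : AdjacencySpace W) (i₀ : Fin n) (F F' : Fin n → W) : Prop :=
  (∀ i, i ≠ i₀ → F i = F' i) ∧ F i₀ - F' i₀ ∈ V.space

/-- `F` and `F'` are adjacent. -/
def Adjacent (V : AdjacencySpace W) (F F' : Fin n → W) : Prop :=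
  ∃ i₀, AdjacentAt V i₀ F F'

/-- `ε`-differential privacy of the random map `M`, over the class `𝒜` of admissible families. -/
def IsDifferentiallyPrivate {Ω Y : Type*} [MeasurableSpace Ω] [MeasurableSpace Y] (P : Measure Ω)
    (V : AdjacencySpace W) (𝒜 : Set (Fin n → W)) (ε : Fin n → ℝ)
    (M : (Fin n → W) → Ω → Y) : Prop :=
  ∀ F ∈ 𝒜, ∀ F' ∈ 𝒜, ∀ i₀ : Fin n, ∀ h : AdjacentAt V i₀ F F', ∀ O : Set Y, MeasurableSet O →
    P {ω | M F' ω ∈ O} ≤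
      ENNReal.ofReal (Real.exp (ε i₀ * V.norm ⟨F i₀ - F' i₀, h.2⟩)) * P {ω | M F ω ∈ O}

/-- The message-perturbing algorithm `x (k + 1) = a F (x k) (ξ k)`, `ξ k = x k + η k`, preserves
`ε`-differential privacy: for every allowable initial state, the map sending an admissible family
to the whole sequence of transmitted messages is `ε`-differentially private. -/
def PreservesPrivacy {Ω : Type*} [MeasurableSpace Ω] (P : Measure Ω) {m : ℕ}
    (V : AdjacencySpace W) (𝒜 : Set (Fin n → W)) (X₀ : Set (EuclideanSpace ℝ (Fin m)))
    (a : (Fin n → W) →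
      EuclideanSpace ℝ (Fin m) → EuclideanSpace ℝ (Fin m) → EuclideanSpace ℝ (Fin m))
    (η : Ω → ℕ → EuclideanSpace ℝ (Fin m)) (ε : Fin n → ℝ) : Prop :=
  ∀ x₀ ∈ X₀, IsDifferentiallyPrivate P V 𝒜 ε fun F ω => messages (a F) x₀ (η ω)

end Privacy

end MessagePerturbing

end

open MessagePerturbing

/-! Start at `xstar I` and consider the event that the messages converge to `xstar I`. Under `I` it
has positive probability: the noise vanishes almost surely (`ae_tendsto_zero`) and, independently of
how small `δ > 0` is, stays below `δ` forever with positive probability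
(`measure_forall_norm_le_ne_zero`). On the intersection, stability drives the state to `xstar I`
(`UniformlyAttracts.exists_tendsto`).

Privacy compares probabilities up to a finite factor, so the event stays possible under `I'`. Some
noise sequence tending to zero then makes the state of the `I'`-system, which is message minus
noise, converge to `xstar I`. Such a limit is an equilibrium if the system is continuous, and equals
`xstar I'` if it lies inside a robust stability ball; either way there is a contradiction.

`UniformlyAttracts` covers both LISS and continuous 0-LAS systems: its input bound may depend on the
horizon, which is all that continuity can give. -/

namespace MessagePerturbing

/-! ### Convergence of solutions under small, vanishing inputs. -/

section Stability

variable {X U : Type*}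

lemma trajectory_add (f : X → U → X) (x₀ : X) (η : ℕ → U) (j t : ℕ) :
    trajectory f x₀ η (j + t) =
      trajectory f (trajectory f x₀ η j) (fun i => η (j + i)) t := by
  induction t with
  | zero => rfl
  | succ t ih => rw [← add_assoc, trajectory, ih, trajectory]

variable [NormedAddCommGroup X] [NormedAddCommGroup U]

/-- After some time, all solutions starting in the closed ball of radius `ρ` about `xs` stay within
any prescribed distance of `xs` over any prescribed horizon, provided the input is small. -/
def UniformlyAttracts (f : X → U → X) (xs : X) (ρ : ℝ) : Prop :=
  ∀ r > 0, ∃ T, ∀ N, ∃ δ > 0, ∀ x₀ ∈ Metric.closedBall xs ρ, ∀ η : ℕ → U,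
    (∀ k, ‖η k‖ ≤ δ) → ∀ t, T ≤ t → t ≤ N → ‖trajectory f x₀ η t - xs‖ ≤ r

lemma IsRobustStabilityRadius.uniformlyAttracts {f : X → U → X} {xs : X} {ρ : ℝ}
    (h : IsRobustStabilityRadius f xs ρ) : UniformlyAttracts f xs ρ := by
  obtain ⟨hρ, γ, κ, hγ, hκ, H⟩ := h
  intro r hr
  lift r to ℝ≥0 using hr.le
  lift ρ to ℝ≥0 using hρ.le
  have hr' : 0 < r := by exact_mod_cast hr
  obtain ⟨s, hs⟩ : ∃ s, ∀ k : ℕ, s ≤ k → γ ρ k ≤ r := by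
    have h1 := ((hγ.tendsto_zero ρ).comp tendsto_natCast_atTop_atTop).eventually
      (eventually_le_nhds hr')
    exact eventually_atTop.1 h1
  obtain ⟨d, hd, hdr⟩ : ∃ d : ℝ≥0, 0 < d ∧ κ d ≤ r := by
    have h1 : Tendsto κ (𝓝[>] 0) (𝓝 0) := by
      have := hκ.continuous.tendsto 0
      rw [hκ.map_zero] at this
      exact this.mono_left nhdsWithin_le_nhds
    obtain ⟨d, h2, h3⟩ := ((h1.eventually (eventually_le_nhds hr')).and
      self_mem_nhdsWithin).exists
    exact ⟨d, h3, h2⟩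
  -- The estimate is available only from time `1` on and for inputs bounded by `ρ`.
  refine ⟨max s 1, fun N => ⟨min d ρ, lt_min (by exact_mod_cast hd) hρ, ?_⟩⟩
  intro x₀ hx₀ η hη t ht _
  have key := H x₀ hx₀ η (fun k => (hη k).trans (min_le_right _ _)) t
    ((le_max_right _ _).trans ht)
  have hx : ‖x₀ - xs‖₊ ≤ ρ := by
    rw [Metric.mem_closedBall, dist_eq_norm] at hx₀
    exact_mod_cast hx₀
  have : ‖trajectory f x₀ η t - xs‖₊ ≤ r := by
    refine key.trans (max_le ?_ ?_)
    · exact (hγ.monotone t hx).trans (hs t ((le_max_left _ _).trans ht))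
    · refine (hκ.strictMono.monotone (Finset.sup_le fun j _ => ?_)).trans hdr
      have := (hη j).trans (min_le_left _ _)
      exact_mod_cast this
  exact_mod_cast this

lemma continuous_trajectory {f : X → U → X} (hf : Continuous fun z : X × U => f z.1 z.2) (k : ℕ) :
    Continuous fun z : X × (ℕ → U) => trajectory f z.1 z.2 k := by
  induction k with
  | zero => exact continuous_fst
  | succ k ih => exact hf.comp (ih.prodMk ((continuous_apply k).comp continuous_snd))

/-- On compact sets of initial states, finite-time solutions depend uniformly continuously on the
input at the zero input. -/
lemma eventually_norm_trajectory_sub_lt {f : X → U → X}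
    (hf : Continuous fun z : X × U => f z.1 z.2) {K : Set X} (hK : IsCompact K) {r : ℝ}
    (hr : 0 < r) (t : ℕ) :
    ∀ᶠ δ : ℝ in 𝓝[>] 0, ∀ x₀ ∈ K, ∀ η : ℕ → U, (∀ k, ‖η k‖ ≤ δ) →
      ‖trajectory f x₀ η t - trajectory f x₀ (fun _ => 0) t‖ < r := by
  have hcont := continuous_trajectory hf t
  have hopen : IsOpen {z : X × (ℕ → U) |
      ‖trajectory f z.1 z.2 t - trajectory f z.1 (fun _ => 0) t‖ < r} :=
    isOpen_lt (hcont.sub (hcont.comp (continuous_fst.prodMk continuous_const))).norm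
      continuous_const
  obtain ⟨u, v, -, hv, hKu, h0v, huv⟩ := generalized_tube_lemma hK
    (isCompact_singleton (x := (fun _ => 0 : ℕ → U))) hopen (by
      rintro ⟨x, η⟩ ⟨-, rfl⟩
      simpa using hr)
  -- A product neighbourhood of the zero input constrains only finitely many times, so a uniform
  -- bound on the input suffices.
  obtain ⟨s, w, hw, hsw⟩ := isOpen_pi_iff.1 hv _ (h0v rfl)
  have hsmall : ∀ᶠ δ : ℝ in 𝓝[>] 0, ∀ j ∈ s, Metric.closedBall (0 : U) δ ⊆ w j := by
    refine (Filter.eventually_all_finset s).2 fun j hj => ?_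
    obtain ⟨d, hd, hdw⟩ := Metric.isOpen_iff.1 (hw j hj).1 _ (hw j hj).2
    filter_upwards [nhdsWithin_le_nhds (eventually_lt_nhds hd)] with δ hδ
    exact (Metric.closedBall_subset_ball hδ).trans hdw
  filter_upwards [hsmall] with δ hδ x₀ hx₀ η hη
  exact huv (Set.mk_mem_prod (hKu hx₀) (hsw fun j hj => hδ j hj (by simpa using hη j)))

/-- Unforced solutions are within `r / 2` after a uniform time; compactness of the ball makes the
effect of small inputs at most `r / 2` over a finite horizon. -/
lemma IsZeroLAS.exists_uniformlyAttracts [ProperSpace X] {f : X → U → X} {xs : X}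
    (h : IsZeroLAS f xs) (hf : Continuous fun z : X × U => f z.1 z.2) :
    ∃ ρ > 0, UniformlyAttracts f xs ρ := by
  obtain ⟨ρ, hρ, γ, hγ, H⟩ := h
  refine ⟨ρ, hρ, fun r hr => ?_⟩
  lift ρ to ℝ≥0 using hρ.le
  obtain ⟨T, hT⟩ : ∃ T, ∀ k : ℕ, T ≤ k → (γ ρ k : ℝ) ≤ r / 2 := by
    have h1 := ((hγ.tendsto_zero ρ).comp tendsto_natCast_atTop_atTop).eventually
      (eventually_le_nhds (show 0 < (r / 2).toNNReal by simpa using hr))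
    obtain ⟨T, hT⟩ := eventually_atTop.1 h1
    exact ⟨T, fun k hk => (Real.le_toNNReal_iff_coe_le (by positivity)).1 (hT k hk)⟩
  refine ⟨T, fun N => ?_⟩
  obtain ⟨δ, hδ, hδ0⟩ := (((Filter.eventually_all_finset (Finset.range (N + 1))).2 fun t _ =>
    eventually_norm_trajectory_sub_lt hf (isCompact_closedBall xs ρ) (half_pos hr) t).and
      self_mem_nhdsWithin).exists
  refine ⟨δ, hδ0, fun x₀ hx₀ η hη t hTt htN => ?_⟩
  have h1 := hδ t (by simpa using Nat.lt_succ_of_le htN) x₀ hx₀ η hη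
  have hx : ‖x₀ - xs‖₊ ≤ ρ := by
    rw [Metric.mem_closedBall, dist_eq_norm] at hx₀
    exact_mod_cast hx₀
  have h2 : ‖trajectory f x₀ (fun _ => 0) t - xs‖ ≤ γ ρ t := by
    exact_mod_cast (H x₀ hx₀ t).trans (hγ.monotone t hx)
  calc ‖trajectory f x₀ η t - xs‖
      ≤ ‖trajectory f x₀ η t - trajectory f x₀ (fun _ => 0) t‖ +
        ‖trajectory f x₀ (fun _ => 0) t - xs‖ := norm_sub_le_norm_sub_add_norm_sub ..
    _ ≤ r / 2 + r / 2 := add_le_add h1.le (h2.trans (hT t hTt))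
    _ = r := add_halves r

/-- If the ball of radius `ρ` is uniformly attracted to `xs`, then solutions from it with small
inputs that vanish at infinity converge to `xs`. -/
lemma UniformlyAttracts.exists_tendsto {f : X → U → X} {xs : X} {ρ : ℝ} (hρ : 0 < ρ)
    (h : UniformlyAttracts f xs ρ) :
    ∃ δ > 0, ∀ x₀ ∈ Metric.closedBall xs ρ, ∀ η : ℕ → U, (∀ k, ‖η k‖ ≤ δ) →
      Tendsto η atTop (𝓝 0) → Tendsto (trajectory f x₀ η) atTop (𝓝 xs) := by
  obtain ⟨T₀, hT₀⟩ := h ρ hρ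
  -- The successor makes the block length positive, as the division by `T` below requires.
  set T := T₀ + 1
  obtain ⟨δ, hδ, hball⟩ := hT₀ T
  refine ⟨δ, hδ, fun x₀ hx₀ η hη hlim => ?_⟩
  have hmem : ∀ j, trajectory f x₀ η (j * T) ∈ Metric.closedBall xs ρ := by
    intro j
    induction j with
    | zero => simpa [trajectory] using hx₀
    | succ j ih =>
      rw [add_mul, one_mul, trajectory_add, Metric.mem_closedBall, dist_eq_norm]
      exact hball _ ih _ (fun k => hη _) T (Nat.le_succ _) le_rfl
  rw [Metric.tendsto_atTop']
  intro r hr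
  obtain ⟨S, hS⟩ := h (r / 2) (half_pos hr)
  obtain ⟨d, hd, hd'⟩ := hS (S + T)
  obtain ⟨K, hK⟩ := Metric.tendsto_atTop.1 hlim d hd
  refine ⟨K * T + S, fun k hk => ?_⟩
  have hTpos : 0 < T := Nat.succ_pos _
  -- Restart at the multiple `j * T` for which the remaining time lies in `[S, S + T)`; there the
  -- state is in the ball and the input is already below `d`.
  obtain ⟨j, hjk⟩ : ∃ j, j = (k - S) / T := ⟨_, rfl⟩
  have hj : K ≤ j := hjk ▸ (Nat.le_div_iff_mul_le hTpos).2 (by omega)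
  have hKj : K ≤ j * T := hj.trans (Nat.le_mul_of_pos_right _ hTpos)
  have hle : j * T ≤ k - S := hjk ▸ Nat.div_mul_le_self _ _
  have hlt : k - S < j * T + T := hjk ▸ Nat.lt_div_mul_add hTpos
  obtain ⟨t, rfl⟩ : ∃ t, k = j * T + t := ⟨k - j * T, by omega⟩
  rw [trajectory_add, dist_eq_norm]
  refine (hd' _ (hmem j) _ (fun i => ?_) t (by omega) (by omega)).trans_lt (half_lt_self hr)
  simpa using (hK (j * T + i) (by omega)).le

/-- A solution with vanishing input can only converge, within an open set of uniformly attracted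
initial states, to the attracting point. -/
lemma UniformlyAttracts.eq_of_tendsto {f : X → U → X} {xs : X} {ρ : ℝ}
    (h : UniformlyAttracts f xs ρ) {x₀ y : X} (hy : y ∈ interior (Metric.closedBall xs ρ))
    {η : ℕ → U} (hη : Tendsto η atTop (𝓝 0))
    (hx : Tendsto (trajectory f x₀ η) atTop (𝓝 y)) : y = xs := by
  refine eq_of_norm_sub_le_zero (le_of_forall_pos_le_add fun r hr => ?_)
  obtain ⟨T, hT⟩ := h r hr
  obtain ⟨δ, hδ, H⟩ := hT T
  have hnear : ∀ᶠ k in atTop, trajectory f x₀ η k ∈ Metric.closedBall xs ρ :=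
    hx.eventually (mem_of_superset (isOpen_interior.mem_nhds hy) interior_subset)
  obtain ⟨K, hK⟩ := Metric.tendsto_atTop.1 hη δ hδ
  have hlim : Tendsto (fun k => ‖trajectory f x₀ η (k + T) - xs‖) atTop (𝓝 ‖y - xs‖) :=
    ((hx.comp (tendsto_add_atTop_nat T)).sub_const xs).norm
  rw [zero_add]
  refine le_of_tendsto hlim ?_
  filter_upwards [hnear, eventually_ge_atTop K] with k hk hKk
  rw [trajectory_add]
  exact H _ hk _ (fun i => by simpa using (hK (k + i) (by omega)).le) T le_rfl le_rfl

/-- The limit of a solution with vanishing input of a continuous system is an equilibrium. -/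
lemma map_zero_eq_of_tendsto_trajectory {f : X → U → X}
    (hf : Continuous fun z : X × U => f z.1 z.2) {x₀ y : X} {η : ℕ → U}
    (hη : Tendsto η atTop (𝓝 0)) (hx : Tendsto (trajectory f x₀ η) atTop (𝓝 y)) : f y 0 = y :=
  tendsto_nhds_unique ((hf.tendsto (y, 0)).comp (hx.prodMk_nhds hη))
    (hx.comp (tendsto_add_atTop_nat 1))

end Stability

end MessagePerturbing

namespace MessagePerturbing

section Noise

/-! ### Tails of the noise distributions -/

lemma measurable_laplace_density (b : ℝ) :
    Measurable fun x : ℝ => ENNReal.ofReal (1 / (2 * b) * Real.exp (-|x| / b)) := by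
  fun_prop

lemma laplace_univ {b : ℝ} (hb : 0 < b) : laplace b Set.univ = 1 := by
  have hint : ∫ x : ℝ, 1 / (2 * b) * Real.exp (-|x| / b) = 1 := by
    rw [integral_comp_abs (f := fun x => 1 / (2 * b) * Real.exp (-x / b)), integral_const_mul]
    have : (fun x : ℝ => Real.exp (-x / b)) = fun x => Real.exp (-(1 / b) * x) := by
      ext x; congr 1; ring
    rw [this, integral_exp_mul_Ioi (by simpa using hb)]
    simp only [mul_zero, Real.exp_zero]
    field_simp
  -- A non-integrable function would have integral `0` by convention.
  have hi : Integrable fun x : ℝ => 1 / (2 * b) * Real.exp (-|x| / b) :=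
    .of_integral_ne_zero (by rw [hint]; exact one_ne_zero)
  rw [laplace, withDensity_apply _ .univ, Measure.restrict_univ,
    ← ofReal_integral_eq_lintegral_ofReal hi (ae_of_all _ fun x => by positivity), hint,
    ENNReal.ofReal_one]

/-- Half of the exponent yields the decay factor; the other half is the density of the Laplace law
of scale `2 * b`, of total mass one. -/
lemma laplace_compl_closedBall_le {b : ℝ} (hb : 0 < b) (δ : ℝ) :
    laplace b (Metric.closedBall 0 δ)ᶜ ≤ ENNReal.ofReal (2 * Real.exp (-(δ / 2) / b)) := by
  rw [laplace, withDensity_apply _ measurableSet_closedBall.compl]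
  calc ∫⁻ x in (Metric.closedBall 0 δ)ᶜ, ENNReal.ofReal (1 / (2 * b) * Real.exp (-|x| / b))
      ≤ ∫⁻ x in (Metric.closedBall 0 δ)ᶜ, ENNReal.ofReal (2 * Real.exp (-(δ / 2) / b)) *
          ENNReal.ofReal (1 / (2 * (2 * b)) * Real.exp (-|x| / (2 * b))) := by
        refine setLIntegral_mono' measurableSet_closedBall.compl fun x hx => ?_
        have hx' : δ < |x| := by simpa using hx
        rw [← ENNReal.ofReal_mul (by positivity)]
        refine ENNReal.ofReal_le_ofReal ?_
        have h1 : Real.exp (-|x| / b) ≤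
            Real.exp (-(δ / 2) / b) * Real.exp (-|x| / (2 * b)) := by
          rw [← Real.exp_add, Real.exp_le_exp, div_add_div _ _ hb.ne' (by positivity),
            div_le_div_iff₀ hb (by positivity)]
          nlinarith [mul_pos hb hb, mul_pos (mul_pos hb hb) (sub_pos.2 hx')]
        calc 1 / (2 * b) * Real.exp (-|x| / b)
            ≤ 1 / (2 * b) * (Real.exp (-(δ / 2) / b) * Real.exp (-|x| / (2 * b))) := by gcongr
          _ = _ := by field_simp
    _ ≤ ∫⁻ x, ENNReal.ofReal (2 * Real.exp (-(δ / 2) / b)) *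
          ENNReal.ofReal (1 / (2 * (2 * b)) * Real.exp (-|x| / (2 * b))) :=
        setLIntegral_le_lintegral _ _
    _ = ENNReal.ofReal (2 * Real.exp (-(δ / 2) / b)) * laplace (2 * b) Set.univ := by
        rw [lintegral_const_mul _ (measurable_laplace_density (2 * b)), laplace,
          withDensity_apply _ .univ, Measure.restrict_univ]
    _ = _ := by rw [laplace_univ (by positivity), mul_one]

/-- Two Chernoff bounds, at the optimal parameters `±δ / v`. -/
lemma gaussianReal_compl_closedBall_le {v : ℝ≥0} (hv : 0 < v) {δ : ℝ} (hδ : 0 ≤ δ) :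
    gaussianReal 0 v (Metric.closedBall 0 δ)ᶜ ≤
      ENNReal.ofReal (2 * Real.exp (-(δ ^ 2 / 2) / v)) := by
  have hv' : (0 : ℝ) < v := by exact_mod_cast hv
  have hsub : (Metric.closedBall (0 : ℝ) δ)ᶜ ⊆ {x | δ ≤ id x} ∪ {x | id x ≤ -δ} := by
    intro x hx
    have hx' : δ < |x| := by simpa using hx
    rcases lt_abs.1 hx' with h | h
    · exact Or.inl h.le
    · exact Or.inr (show x ≤ -δ by linarith)
  have h1 := measure_ge_le_exp_mul_mgf (X := id) (μ := gaussianReal 0 v) (t := δ / v) δ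
    (by positivity) (integrable_exp_mul_gaussianReal _)
  have h2 := measure_le_le_exp_mul_mgf (X := id) (μ := gaussianReal 0 v) (t := -(δ / v)) (-δ)
    (by simpa using by positivity) (integrable_exp_mul_gaussianReal _)
  rw [mgf_id_gaussianReal, ← Real.exp_add] at h1 h2
  have e1 : -(δ / v) * δ + (0 * (δ / v) + v * (δ / v) ^ 2 / 2) = -(δ ^ 2 / 2) / v := by
    field_simp; ring
  have e2 : - -(δ / v) * -δ + (0 * -(δ / v) + v * (-(δ / v)) ^ 2 / 2) = -(δ ^ 2 / 2) / v := by
    field_simp; ring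
  rw [e1] at h1
  rw [e2] at h2
  refine ENNReal.le_ofReal_iff_toReal_le (measure_ne_top _ _) (by positivity) |>.2 ?_
  calc (gaussianReal 0 v).real (Metric.closedBall 0 δ)ᶜ
      ≤ (gaussianReal 0 v).real ({x | δ ≤ id x} ∪ {x | id x ≤ -δ}) := measureReal_mono hsub
    _ ≤ _ := (measureReal_union_le _ _).trans (by linarith)

lemma volume_absolutelyContinuous_laplace {b : ℝ} (hb : 0 < b) : volume ≪ laplace b :=
  withDensity_absolutelyContinuous' (measurable_laplace_density b).aemeasurable
    (ae_of_all _ fun x => (ENNReal.ofReal_pos.2 (by positivity)).ne')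

/-- Stretched-exponential tails with polynomially decaying scales are summable. -/
lemma summable_exp_neg_div {b : ℕ → ℝ≥0} (hb0 : ∀ k, 0 < b k) {p : ℝ} (hp : 0 < p)
    (hb : (fun k : ℕ => (b k : ℝ)) =O[atTop] fun k : ℕ => 1 / (k : ℝ) ^ p) {c : ℝ} (hc : 0 < c) :
    Summable fun k => 2 * Real.exp (-c / b k) := by
  -- With `p * q > 1` the `q`-th power of the bound on `b` is summable, and `exp (-x)` is dominated
  -- by a multiple of `x ^ (-q)`.
  obtain ⟨q, hq⟩ := exists_nat_gt (1 / p)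
  have hpq : 1 < p * q := by rwa [div_lt_iff₀' hp] at hq
  have hsum : Summable fun k : ℕ => (1 / (k : ℝ) ^ p) ^ q := by
    refine (Real.summable_one_div_nat_rpow.2 hpq).congr fun k => ?_
    rw [div_pow, one_pow, Real.rpow_mul_natCast (Nat.cast_nonneg k)]
  suffices h : (fun k => Real.exp (-c / b k)) =O[atTop] fun k => (b k : ℝ) ^ q from
    (summable_of_isBigO_nat hsum (h.trans (hb.pow q))).mul_left 2
  obtain ⟨C, hC⟩ : ∃ C : ℝ, ∀ x : ℝ, 0 < x → Real.exp (-x) ≤ C * (x ^ q)⁻¹ := by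
    refine ⟨q.factorial, fun x hx => ?_⟩
    have h := Real.pow_div_factorial_le_exp x hx.le q
    have h1 := inv_anti₀ (by positivity) h
    rwa [inv_div, div_eq_mul_inv, ← Real.exp_neg] at h1
  refine IsBigO.of_bound (C / c ^ q) (Eventually.of_forall fun k => ?_)
  have hbk : (0 : ℝ) < b k := by exact_mod_cast hb0 k
  have h := hC (c / b k) (by positivity)
  rw [Real.norm_of_nonneg (Real.exp_pos _).le, Real.norm_of_nonneg (by positivity), neg_div]
  rwa [div_pow, inv_div, ← mul_div_assoc, mul_div_right_comm] at h

/-! ### Independence -/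

/-- Countably many independent events of positive probability occur simultaneously with positive
probability if the probabilities of their complements are summable. -/
lemma measure_iInter_preimage_ne_zero {Ω ι β : Type*} [MeasurableSpace Ω] [MeasurableSpace β]
    [Countable ι] {P : Measure Ω} [IsProbabilityMeasure P] {f : ι → Ω → β}
    (hf : ∀ i, Measurable (f i)) (hind : iIndepFun f P) {s : ι → Set β}
    (hs : ∀ i, MeasurableSet (s i)) (hpos : ∀ i, P (f i ⁻¹' s i) ≠ 0)
    (hsum : ∑' i, P (f i ⁻¹' (s i)ᶜ) ≠ ∞) : P (⋂ i, f i ⁻¹' s i) ≠ 0 := by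
  -- Outside `F` the failure probabilities sum to less than one, so a union bound handles the tail;
  -- the finite block is a product of positive factors, and the two blocks are independent.
  obtain ⟨F, hF⟩ := ((ENNReal.tendsto_tsum_compl_atTop_zero hsum).eventually
    (eventually_lt_nhds zero_lt_one)).exists
  set m : ι → MeasurableSpace Ω := fun i => MeasurableSpace.comap (f i) inferInstance
  have hm : ∀ i, MeasurableSet[m i] (f i ⁻¹' s i) := fun i => ⟨s i, hs i, rfl⟩
  have hindep := indep_iSup_of_disjoint (fun i => (hf i).comap_le) hind.iIndep
    (disjoint_compl_right (a := (F : Set ι)))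
  have hmeas : ∀ S : Set ι, MeasurableSet[⨆ i ∈ S, m i] (⋂ i ∈ S, f i ⁻¹' s i) := fun S =>
    @MeasurableSet.biInter _ _ (⨆ i ∈ S, m i) _ _ S.to_countable fun i hi =>
      le_iSup₂_of_le (f := fun i (_ : i ∈ S) => m i) i hi le_rfl _ (hm i)
  have hprod := (Indep_iff _ _ P).1 hindep _ _ (hmeas F) (hmeas (F : Set ι)ᶜ)
  have hset : ⋂ i, f i ⁻¹' s i =
      (⋂ i ∈ (F : Set ι), f i ⁻¹' s i) ∩ ⋂ i ∈ (F : Set ι)ᶜ, f i ⁻¹' s i := by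
    ext ω
    simp only [Set.mem_iInter, Set.mem_inter_iff, Set.mem_compl_iff]
    exact ⟨fun h => ⟨fun i _ => h i, fun i _ => h i⟩, fun h i =>
      (em (i ∈ (F : Set ι))).elim (h.1 i) (h.2 i)⟩
  rw [hset, hprod]
  refine mul_ne_zero ?_ fun h0 => ?_
  · have := hind.meas_biInter (S := F) fun i _ => hm i
    simp only [Finset.mem_coe]
    rw [this]
    exact Finset.prod_ne_zero_iff.2 fun i _ => hpos i
  · have hmeas' : MeasurableSet (⋂ i ∈ (F : Set ι)ᶜ, f i ⁻¹' s i) :=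
      .biInter (Set.to_countable _) fun i _ => hf i (hs i)
    have h1 := (prob_compl_eq_one_iff hmeas').2 h0
    have h2 : (⋂ i ∈ (F : Set ι)ᶜ, f i ⁻¹' s i)ᶜ = ⋃ i : {x // x ∉ F}, f i ⁻¹' (s i)ᶜ := by
      ext ω
      simp
    rw [h2] at h1
    exact absurd (measure_iUnion_le (μ := P) fun i : {x // x ∉ F} => f i ⁻¹' (s i)ᶜ)
      (by rw [h1]; exact not_le.2 hF)

/-! ### Small and vanishing noise -/

variable {Ω : Type*} [MeasurableSpace Ω] {P : Measure Ω} {m : ℕ}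
  {b : Fin m → ℕ → ℝ≥0} {η : Ω → ℕ → EuclideanSpace ℝ (Fin m)}

lemma IsLaplaceOrGaussianNoise.measure_coord_ne_zero (hη : IsLaplaceOrGaussianNoise P b η)
    {δ : ℝ} (hδ : 0 < δ) (k : ℕ) (i : Fin m) :
    P ((fun ω => η ω k i) ⁻¹' Metric.closedBall 0 δ) ≠ 0 := by
  rw [← Measure.map_apply (hη.measurable k i) measurableSet_closedBall]
  have hvol : volume (Metric.closedBall (0 : ℝ) δ) ≠ 0 :=
    (Metric.measure_closedBall_pos volume _ hδ).ne'
  have hpos := hη.scale_pos i k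
  rcases hη.law k i with h | h <;> rw [h]
  · exact fun h0 => hvol (volume_absolutelyContinuous_laplace (by exact_mod_cast hpos) h0)
  · exact fun h0 => hvol (gaussianReal_absolutelyContinuous' 0 hpos.ne' h0)

lemma IsLaplaceOrGaussianNoise.measure_coord_compl_le (hη : IsLaplaceOrGaussianNoise P b η)
    {δ : ℝ} (hδ : 0 < δ) (k : ℕ) (i : Fin m) :
    P ((fun ω => η ω k i) ⁻¹' (Metric.closedBall 0 δ)ᶜ) ≤
      ENNReal.ofReal (2 * Real.exp (-(min (δ / 2) (δ ^ 2 / 2)) / b i k)) := by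
  rw [← Measure.map_apply (hη.measurable k i) measurableSet_closedBall.compl]
  have hpos : (0 : ℝ) < b i k := by exact_mod_cast hη.scale_pos i k
  rcases hη.law k i with h | h <;> rw [h]
  · refine (laplace_compl_closedBall_le hpos δ).trans ?_
    gcongr
    exact min_le_left _ _
  · refine (gaussianReal_compl_closedBall_le (hη.scale_pos i k) hδ.le).trans ?_
    gcongr
    exact min_le_right _ _

lemma IsLaplaceOrGaussianNoise.tsum_measure_coord_compl_ne_top
    (hη : IsLaplaceOrGaussianNoise P b η) {p : ℝ} (hp : 0 < p)
    (hb : ∀ i, (fun k : ℕ => (b i k : ℝ)) =O[atTop] fun k : ℕ => 1 / (k : ℝ) ^ p)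
    {δ : ℝ} (hδ : 0 < δ) (i : Fin m) :
    ∑' k, P ((fun ω => η ω k i) ⁻¹' (Metric.closedBall 0 δ)ᶜ) ≠ ∞ := by
  have hsum := summable_exp_neg_div (hη.scale_pos i) hp (hb i)
    (c := min (δ / 2) (δ ^ 2 / 2)) (by positivity)
  exact ne_top_of_le_ne_top hsum.tsum_ofReal_ne_top
    (ENNReal.tsum_le_tsum fun k => hη.measure_coord_compl_le hδ k i)

/-- Borel–Cantelli for each coordinate and each radius `1 / (r + 1)`. -/
lemma IsLaplaceOrGaussianNoise.ae_tendsto_zero (hη : IsLaplaceOrGaussianNoise P b η)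
    {p : ℝ} (hp : 0 < p)
    (hb : ∀ i, (fun k : ℕ => (b i k : ℝ)) =O[atTop] fun k : ℕ => 1 / (k : ℝ) ^ p) :
    ∀ᵐ ω ∂P, Tendsto (η ω) atTop (𝓝 0) := by
  have h : ∀ᵐ ω ∂P, ∀ (i : Fin m) (r : ℕ), ∀ᶠ k in atTop,
      ω ∉ (fun ω => η ω k i) ⁻¹' (Metric.closedBall 0 (1 / ((r : ℝ) + 1)))ᶜ :=
    ae_all_iff.2 fun i => ae_all_iff.2 fun r => ae_eventually_notMem
      (hη.tsum_measure_coord_compl_ne_top hp hb Nat.one_div_pos_of_nat i)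
  filter_upwards [h] with ω hω
  have hcoord : Tendsto (fun k i => η ω k i) atTop (𝓝 0) := by
    refine tendsto_pi_nhds.2 fun i => Metric.nhds_basis_closedBall.tendsto_right_iff.2 ?_
    intro d hd
    obtain ⟨r, hr⟩ := exists_nat_one_div_lt hd
    filter_upwards [hω i r] with k hk
    exact Metric.closedBall_subset_closedBall hr.le (not_not.1 hk)
  exact ((PiLp.continuous_toLp 2 fun _ : Fin m => ℝ).tendsto 0).comp hcoord

lemma IsLaplaceOrGaussianNoise.measure_forall_norm_le_ne_zero [IsProbabilityMeasure P]
    (hη : IsLaplaceOrGaussianNoise P b η) {p : ℝ} (hp : 0 < p)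
    (hb : ∀ i, (fun k : ℕ => (b i k : ℝ)) =O[atTop] fun k : ℕ => 1 / (k : ℝ) ^ p)
    {δ : ℝ} (hδ : 0 < δ) : P {ω | ∀ k, ‖η ω k‖ ≤ δ} ≠ 0 := by
  -- Coordinates below `d` give norm at most `√m * d ≤ δ`; the `+ 1` covers `m = 0`.
  set d : ℝ := δ / (m + 1)
  have hd : 0 < d := by positivity
  have hsum : ∑' j : ℕ × Fin m,
      P ((fun ω => η ω j.1 j.2) ⁻¹' (Metric.closedBall 0 d)ᶜ) ≠ ∞ := by
    rw [ENNReal.tsum_prod', ENNReal.tsum_comm, tsum_fintype]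
    exact ENNReal.sum_ne_top.2 fun i _ => hη.tsum_measure_coord_compl_ne_top hp hb hd i
  have h := measure_iInter_preimage_ne_zero (fun j : ℕ × Fin m => hη.measurable j.1 j.2)
    hη.indep (fun _ => measurableSet_closedBall)
    (fun j => hη.measure_coord_ne_zero hd j.1 j.2) hsum
  refine fun h0 => h (measure_mono_null (t := {ω | ∀ k, ‖η ω k‖ ≤ δ}) (fun ω hω k => ?_) h0)
  have hω' : ∀ i, |η ω k i| ≤ d := fun i => by simpa using Set.mem_iInter.1 hω (k, i)
  refine abs_le_of_sq_le_sq' ?_ hδ.le |>.2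
  rw [EuclideanSpace.real_norm_sq_eq]
  calc ∑ i, η ω k i ^ 2 ≤ ∑ _i : Fin m, d ^ 2 :=
        Finset.sum_le_sum fun i _ => sq_le_sq.2 ((hω' i).trans (le_abs_self d))
    _ = m * d ^ 2 := by simp
    _ ≤ ((m + 1) * d) ^ 2 := by
        rw [mul_pow]
        gcongr
        nlinarith [(Nat.cast_nonneg m : (0 : ℝ) ≤ m)]
    _ = δ ^ 2 := by simp only [d]; field_simp

end Noise

section Privacy

/-! ### Privacy and supports of message laws -/

variable {Ω Y W : Type*} [MeasurableSpace Ω] [MeasurableSpace Y] [AddCommGroup W] [Module ℝ W]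
  {n : ℕ}

lemma AdjacentAt.symm {V : AdjacencySpace W} {i₀ : Fin n} {F F' : Fin n → W}
    (h : AdjacentAt V i₀ F F') : AdjacentAt V i₀ F' F :=
  ⟨fun i hi => (h.1 i hi).symm, by simpa using V.space.neg_mem h.2⟩

/-- Under differential privacy, an event that is possible for one information set is possible for
every information set joined to it by a chain of adjacent admissible ones. -/
lemma IsDifferentiallyPrivate.measure_ne_zero {P : Measure Ω} {V : AdjacencySpace W}
    {𝒜 : Set (Fin n → W)} {ε : Fin n → ℝ} {M : (Fin n → W) → Ω → Y}
    (h : IsDifferentiallyPrivate P V 𝒜 ε M) {F F' : Fin n → W}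
    (hchain : Relation.ReflTransGen (fun F F' => F ∈ 𝒜 ∧ F' ∈ 𝒜 ∧ Adjacent V F F') F F')
    {O : Set Y} (hO : MeasurableSet O) (hF : P {ω | M F ω ∈ O} ≠ 0) :
    P {ω | M F' ω ∈ O} ≠ 0 := by
  induction hchain with
  | refl => exact hF
  | tail _ hstep ih =>
    obtain ⟨hB, hC, i₀, hadj⟩ := hstep
    intro h0
    -- Adjacency is reversed so that a null event for the later set would be null for the earlier
    -- one.
    have := h _ hC _ hB i₀ hadj.symm O hO
    rw [h0, mul_zero] at this
    exact ih (nonpos_iff_eq_zero.1 this)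

end Privacy

end MessagePerturbing

theorem mainTheorem1
    {Ω : Type*} [MeasurableSpace Ω] (P : Measure Ω) [IsProbabilityMeasure P]
    {W : Type*} [AddCommGroup W] [Module ℝ W] {n m : ℕ}
    -- adjacency space, admissible information sets, allowable initial states
    (V : AdjacencySpace W) (𝒜 : Set (Fin n → W)) (X₀ : Set (EuclideanSpace ℝ (Fin m)))
    -- the algorithm and the optimizer associated with each information set
    (a : (Fin n → W) →
      EuclideanSpace ℝ (Fin m) → EuclideanSpace ℝ (Fin m) → EuclideanSpace ℝ (Fin m))
    (xstar : (Fin n → W) → EuclideanSpace ℝ (Fin m))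
    -- the noise
    (b : Fin m → ℕ → ℝ≥0) (η : Ω → ℕ → EuclideanSpace ℝ (Fin m))
    (hη : IsLaplaceOrGaussianNoise P b η)
    (p : ℝ) (hp : 0 < p)
    (hb : ∀ i, (fun k : ℕ => (b i k : ℝ)) =O[atTop] fun k : ℕ => 1 / (k : ℝ) ^ p)
    -- the two information sets
    (I I' : Fin n → W)
    (hII' : Relation.ReflTransGen
      (fun F F' => F ∈ 𝒜 ∧ F' ∈ 𝒜 ∧ Adjacent V F F') I I')
    (hne : xstar I ≠ xstar I') (hX₀ : xstar I ∈ X₀)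
    (hI : IsZeroLAS (perturbedSystem (a I)) (xstar I))
    (hI' : IsZeroLAS (perturbedSystem (a I')) (xstar I'))
    (hreg : IsLISS (perturbedSystem (a I)) (xstar I) ∨
      Continuous fun z : EuclideanSpace ℝ (Fin m) × EuclideanSpace ℝ (Fin m) =>
        perturbedSystem (a I) z.1 z.2)
    (hcond :
      (perturbedSystem (a I') (xstar I) 0 ≠ xstar I ∧
        Continuous fun z : EuclideanSpace ℝ (Fin m) × EuclideanSpace ℝ (Fin m) =>
          perturbedSystem (a I') z.1 z.2) ∨
      (∃ ρ' : ℝ, IsRobustStabilityRadius (perturbedSystem (a I')) (xstar I') ρ' ∧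
        xstar I ∈ interior (Metric.closedBall (xstar I') ρ')))
    (ε : Fin n → ℝ) (hε : ∀ i, 0 < ε i) :
    ¬ PreservesPrivacy P V 𝒜 X₀ a η ε := by
  intro hpriv
  obtain ⟨ρ, hρ, hattr⟩ :
      ∃ ρ > 0, UniformlyAttracts (perturbedSystem (a I)) (xstar I) ρ := by
    rcases hreg with ⟨ρ, h⟩ | hcont
    · exact ⟨ρ, h.1, h.uniformlyAttracts⟩
    · exact hI.exists_uniformlyAttracts hcont
  obtain ⟨δ, hδ, hconv⟩ := hattr.exists_tendsto hρ
  have hlim := hη.ae_tendsto_zero hp hb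
  set O : Set (ℕ → EuclideanSpace ℝ (Fin m)) := {ξ | Tendsto ξ atTop (𝓝 (xstar I))}
  have hO : MeasurableSet O := measurableSet_tendsto _ fun k => measurable_pi_apply k
  have hmsg : P {ω | messages (a I) (xstar I) (η ω) ∈ O} ≠ 0 := by
    refine fun h0 => hη.measure_forall_norm_le_ne_zero hp hb hδ (measure_mono_null_ae ?_ h0)
    filter_upwards [hlim] with ω hω hsmall
    have hx := hconv _ (Metric.mem_closedBall_self hρ.le) (η ω) hsmall hω
    have h := hx.add hω
    rw [add_zero] at h
    exact h
  have hmsg' := (hpriv _ hX₀).measure_ne_zero hII' hO hmsg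
  -- An event of positive probability meets the almost sure event that the noise vanishes.
  obtain ⟨ω, hωO, hω⟩ : ∃ ω, messages (a I') (xstar I) (η ω) ∈ O ∧
      Tendsto (η ω) atTop (𝓝 0) := by
    by_contra! hcon
    exact hmsg' (measure_mono_null (fun ω hωO => hcon ω hωO) (ae_iff.1 hlim))
  have hx : Tendsto (trajectory (perturbedSystem (a I')) (xstar I) (η ω)) atTop
      (𝓝 (xstar I)) := by
    have h := Tendsto.sub (show Tendsto _ _ _ from hωO) hω
    simpa [messages] using h
  rcases hcond with ⟨hneq, hcont⟩ | ⟨ρ', hρ', hint⟩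
  · exact hneq (map_zero_eq_of_tendsto_trajectory hcont hω hx)
  · exact hne (hρ'.uniformlyAttracts.eq_of_tendsto hint hω hx)
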